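/- Let $m,n$ be nonnegative integers and let $D\subset\mathbb{R}^m$ be a convex domain (nonempty, open, convex) with $C^2$ boundary, i.e. near each boundary point, in suitable orthonormal coordinates, $D$ is the region on one side of the graph of a $C^2$ function. Let $F:\mathbb{R}^m\to\mathbb{R}^m$ be locally Lipschitz continuous, and suppose that $$(v-v_0)\cdot F(v)>0\qquad\text{for every } v\in\mathbb{R}^m\setminus\overline{D},$$ where $v_0\in\partial D$ is the boundary point with $|v-v_0|=\operatorname{dist}(v,\partial D)$. Let $u\in C^2(\mathbb{R}^n;\mathbb{R}^m)$ be a bounded solution of $\Delta u=F(u)$ on all of $\mathbb{R}^n$. Then $u(x)\in\overline{D}$ for every $x\in\mathbb{R}^n$. If, in addition, $D$ is strictly convex (for any two distinct points of $\overline{D}$, the open segment between them lies in the interior of $\overline{D}$, which is $D$) and $u$ is not constant, then $u(x)\in D$ for every $x\in\mathbb{R}^n$. -/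

import Mathlib

/-- `D` has `C²` boundary: near each boundary point `p`, and in suitable orthonormal coordinates
whose last axis is the unit vector `e`, the set `D` is the region above the graph of a `C²`
function `γ` of the remaining coordinates. Here `⟪e, x⟫` is the last coordinate of `x`, and
`x - ⟪e, x⟫ • e` is the orthogonal projection of `x` onto the hyperplane `e^⊥`; only the values of
`γ` on that hyperplane are used (every `C²` function on it extends to the whole space by composing
it with the projection). -/
def HasC2Boundary {m : ℕ} (D : Set (EuclideanSpace ℝ (Fin m))) : Prop :=
  ∀ p ∈ frontier D, ∃ r : ℝ, 0 < r ∧ ∃ e : EuclideanSpace ℝ (Fin m), ‖e‖ = 1 ∧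
    ∃ γ : EuclideanSpace ℝ (Fin m) → ℝ, ContDiff ℝ 2 γ ∧
      ∀ x ∈ Metric.ball p r, x ∈ D ↔ γ (x - inner ℝ e x • e) < inner ℝ e x

/-!
The distance function of `D` is never differentiated: it is compared with affine functions vanishing
on supporting hyperplanes, so that the only Laplacians of `u` that occur are those of its components
`⟪ν, u⟫` along fixed vectors, which equal `⟪ν, F u⟫`. The regularity of `∂D` is needed only to show
that a solution with values in `∂D` is constant.

* `u` stays in `closure D` (`mem_closure_of_laplacian_eq`). If `dist (u x, closure D)` is positive
  somewhere, subtracting `ε |x - x₀|²` makes it attain a maximum. There the supporting affine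
  function touches from below, so the outward component of `F` is `O(ε)`; by compactness it is
  bounded below by a positive constant.
* If `u` touches `∂D`, it stays in `∂D` (`mem_frontier_of_laplacian_eq`). The distance `q` of `u x`
  to `∂D` is touched from above by the affine function of a nearest boundary point; since `F` is
  Lipschitz on bounded sets and does not point inwards on `∂D`, `Δq ≤ L q` in the barrier sense, and
  Hopf's argument (`eq_zero_of_laplacian_le_barrier`) gives `q = 0`.
* A solution inside `∂D`, with `D` strictly convex, is constant (`eq_const_of_forall_mem_frontier`).
  The height of `u` over a supporting hyperplane has vanishing pure second derivatives at contact,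
  hence is `o(t²)` along coordinate lines. A `C²` boundary has locally uniform interior balls
  (`HasC2Boundary.exists_interior_ball`), which makes the square of the variation of the normal
  bounded by this height (`IsSupportingNormal.half_mul_norm_sub_sq_le`). So the normal along `u` has
  zero derivative, and by strict convexity a boundary point is determined by its normal.
-/

open Set Filter Topology Metric

/-! ### Second-order calculus along lines and the Laplacian -/

section Calculus

variable {E : Type*} [NormedAddCommGroup E] [InnerProductSpace ℝ E]

lemma deriv_line {f : E → ℝ} (hf : ContDiff ℝ 2 f) (x e : E) (t : ℝ) :
    deriv (fun s : ℝ => f (x + s • e)) t = fderiv ℝ f (x + t • e) e := by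
  have h1 : HasFDerivAt f (fderiv ℝ f (x + t • e)) (x + t • e) :=
    (hf.differentiable (by norm_num) _).hasFDerivAt
  have h2 : HasDerivAt (fun s : ℝ => x + s • e) e t := by
    simpa using ((hasDerivAt_id t).smul_const e).const_add x
  exact (h1.comp_hasDerivAt t h2).deriv

lemma deriv_deriv_line {f : E → ℝ} (hf : ContDiff ℝ 2 f) (x e : E) (t : ℝ) :
    deriv (deriv (fun s : ℝ => f (x + s • e))) t = iteratedFDeriv ℝ 2 f (x + t • e) ![e, e] := by
  have h0 : deriv (fun s : ℝ => f (x + s • e)) = fun s => fderiv ℝ f (x + s • e) e :=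
    funext fun s => deriv_line hf x e s
  rw [h0, iteratedFDeriv_two_apply]
  have hd : ContDiff ℝ 1 (fderiv ℝ f) := hf.fderiv_right (by norm_num)
  have h1 : HasFDerivAt (fderiv ℝ f) (fderiv ℝ (fderiv ℝ f) (x + t • e)) (x + t • e) :=
    (hd.differentiable (by norm_num) _).hasFDerivAt
  have h2 : HasDerivAt (fun s : ℝ => x + s • e) e t := by
    simpa using ((hasDerivAt_id t).smul_const e).const_add x
  have h3 : HasDerivAt (fun s : ℝ => fderiv ℝ f (x + s • e))
      (fderiv ℝ (fderiv ℝ f) (x + t • e) e) t := h1.comp_hasDerivAt t h2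
  have h4 : HasDerivAt (fun s : ℝ => fderiv ℝ f (x + s • e) e)
      (fderiv ℝ (fderiv ℝ f) (x + t • e) e e) t := by
    have h5 : HasFDerivAt (fun l : E →L[ℝ] ℝ => l e) (ContinuousLinearMap.apply ℝ ℝ e)
        (fderiv ℝ f (x + t • e)) := (ContinuousLinearMap.apply ℝ ℝ e).hasFDerivAt
    exact h5.comp_hasDerivAt t h3
  exact h4.deriv

lemma contDiff_line {F : Type*} [NormedAddCommGroup F] [NormedSpace ℝ F] {f : E → F}
    (hf : ContDiff ℝ 2 f) (x e : E) : ContDiff ℝ 2 (fun s : ℝ => f (x + s • e)) := by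
  fun_prop

/-- The necessary second-order condition at a local minimum on the line. -/
lemma IsLocalMin.deriv_deriv_nonneg {g : ℝ → ℝ} {t : ℝ} (h : IsLocalMin g t)
    (hc : ContinuousAt g t) : 0 ≤ deriv (deriv g) t := by
  by_contra! hneg
  -- otherwise `t` is also a local maximum, so `g` is constant near `t`
  have hmax := isLocalMax_of_deriv_deriv_neg hneg h.deriv_eq_zero hc
  have hconst : g =ᶠ[𝓝 t] fun _ => g t := by
    filter_upwards [h, hmax] with s h1 h2 using le_antisymm h2 h1
  have := hconst.deriv.deriv_eq
  simp at this
  exact hneg.ne this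

lemma IsLocalMin.iteratedFDeriv_two_nonneg {f : E → ℝ} (hf : ContDiff ℝ 2 f) {x : E}
    (h : IsLocalMin f x) (e : E) : 0 ≤ iteratedFDeriv ℝ 2 f x ![e, e] := by
  have hl : IsLocalMin (fun s : ℝ => f (x + s • e)) 0 := by
    have hc : ContinuousAt (fun s : ℝ => x + s • e) 0 := by fun_prop
    have h' : IsLocalMin f (x + (0 : ℝ) • e) := by simpa using h
    exact IsLocalMin.comp_continuous (g := fun s : ℝ => x + s • e) h' hc
  have := hl.deriv_deriv_nonneg (contDiff_line hf x e).continuous.continuousAt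
  rw [deriv_deriv_line hf] at this
  simpa using this

/-- Peano form of Taylor's theorem for a function with vanishing second-order jet. -/
lemma isLittleO_sq_of_deriv_deriv_eq_zero {g : ℝ → ℝ} (hg : ContDiff ℝ 2 g) {t : ℝ}
    (h0 : g t = 0) (h1 : deriv g t = 0) (h2 : deriv (deriv g) t = 0) :
    g =o[𝓝 t] fun s => (s - t) ^ 2 := by
  have h2' : iteratedDeriv 2 g t = 0 := by rw [iteratedDeriv_succ, iteratedDeriv_one, h2]
  have h := taylor_isLittleO_univ (x₀ := t) (n := 2) hg
  simpa [taylorWithinEval_succ, taylor_within_zero_eval, iteratedDerivWithin_univ, h0, h1, h2',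
    iteratedDeriv_one] using h

lemma eq_of_forall_basis_line_eq {X : Type*} {ι : Type*} [Fintype ι] (b : OrthonormalBasis ι ℝ E)
    {f : E → X} (h : ∀ x i (t : ℝ), f (x + t • b i) = f x) (x : E) : f x = f 0 := by
  have key : ∀ s : Finset ι, f (∑ i ∈ s, b.repr x i • b i) = f 0 := by
    intro s
    classical
    induction s using Finset.induction_on with
    | empty => simp
    | insert i s hi ih => rw [Finset.sum_insert hi, add_comm, h, ih]
  rw [← key Finset.univ, b.sum_repr]

variable [FiniteDimensional ℝ E]

/-- At a local minimum of `φ - ψ` the Laplacians are ordered. -/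
lemma laplacian_le_of_isLocalMin_sub {φ ψ : E → ℝ} (hφ : ContDiff ℝ 2 φ) (hψ : ContDiff ℝ 2 ψ)
    {x : E} (h : IsLocalMin (φ - ψ) x) :
    Laplacian.laplacian ψ x ≤ Laplacian.laplacian φ x := by
  rw [← sub_nonneg, ← hφ.contDiffAt.laplacian_sub hψ.contDiffAt,
    InnerProductSpace.laplacian_eq_iteratedFDeriv_stdOrthonormalBasis]
  exact Finset.sum_nonneg fun i _ => h.iteratedFDeriv_two_nonneg (hφ.sub hψ) _

lemma laplacian_radial {g g' : ℝ → ℝ} {g'' : ℝ} (c y : E) (hg : ContDiff ℝ 2 g)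
    (h1 : ∀ s, HasDerivAt g (g' s) s) (h2 : HasDerivAt g' g'' (‖y - c‖ ^ 2)) :
    Laplacian.laplacian (fun x => g (‖x - c‖ ^ 2)) y =
      4 * g'' * ‖y - c‖ ^ 2 + 2 * Module.finrank ℝ E * g' (‖y - c‖ ^ 2) := by
  have hC : ContDiff ℝ 2 (fun x : E => g (‖x - c‖ ^ 2)) :=
    hg.comp ((contDiff_id.sub contDiff_const).norm_sq ℝ)
  rw [InnerProductSpace.laplacian_eq_iteratedFDeriv_stdOrthonormalBasis]
  have key : ∀ i, iteratedFDeriv ℝ 2 (fun x : E => g (‖x - c‖ ^ 2)) y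
      ![(stdOrthonormalBasis ℝ E) i, (stdOrthonormalBasis ℝ E) i] =
      4 * g'' * inner ℝ ((stdOrthonormalBasis ℝ E) i) (y - c) ^ 2 + 2 * g' (‖y - c‖ ^ 2) := by
    intro i
    set e := (stdOrthonormalBasis ℝ E) i with he
    have hen : ‖e‖ = 1 := (stdOrthonormalBasis ℝ E).norm_eq_one i
    set b := inner ℝ e (y - c) with hb
    have hpoly : ∀ t : ℝ, ‖y + t • e - c‖ ^ 2 = ‖y - c‖ ^ 2 + 2 * b * t + t ^ 2 := by
      intro t
      have : y + t • e - c = (y - c) + t • e := by abel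
      rw [this, norm_add_sq_real, norm_smul, hen, inner_smul_right, real_inner_comm, ← hb,
        mul_one, Real.norm_eq_abs, sq_abs]
      ring
    have hp : ∀ t : ℝ, HasDerivAt (fun t : ℝ => ‖y - c‖ ^ 2 + 2 * b * t + t ^ 2)
        (2 * b + 2 * t) t := by
      intro t
      have := (((hasDerivAt_id t).const_mul (2 * b)).const_add (‖y - c‖ ^ 2)).add
        ((hasDerivAt_id t).pow 2)
      convert! this using 1
      simp
    have hd1 : deriv (fun s : ℝ => g (‖y + s • e - c‖ ^ 2)) =
        fun t => g' (‖y - c‖ ^ 2 + 2 * b * t + t ^ 2) * (2 * b + 2 * t) := by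
      funext t
      simp_rw [hpoly]
      exact ((h1 _).comp t (hp t)).deriv
    have h := deriv_deriv_line hC y e 0
    rw [hd1] at h
    have h2' : HasDerivAt g' g'' (‖y - c‖ ^ 2 + 2 * b * 0 + 0 ^ 2) := by simpa using h2
    have hlin : HasDerivAt (fun t : ℝ => 2 * b + 2 * t) 2 0 := by
      simpa using ((hasDerivAt_id (0 : ℝ)).const_mul 2).const_add (2 * b)
    have h3 := (((h2'.comp 0 (hp 0)).mul hlin)).deriv
    have h4 : deriv (fun t => g' (‖y - c‖ ^ 2 + 2 * b * t + t ^ 2) * (2 * b + 2 * t)) 0 = _ := h3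
    rw [h4] at h
    simp only [zero_smul, add_zero] at h
    rw [← h]
    simp
    ring
  simp_rw [key]
  rw [Finset.sum_add_distrib, ← Finset.mul_sum]
  have hsum : ∑ i, inner ℝ ((stdOrthonormalBasis ℝ E) i) (y - c) ^ 2 = ‖y - c‖ ^ 2 := by
    simpa using (stdOrthonormalBasis ℝ E).sum_sq_norm_inner_right (y - c)
  rw [hsum]
  simp
  ring

lemma laplacian_mul_norm_sq (a : ℝ) (c y : E) :
    Laplacian.laplacian (fun x : E => a * ‖x - c‖ ^ 2) y = 2 * Module.finrank ℝ E * a := by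
  have h := laplacian_radial (g := fun s => a * s) (g' := fun _ => a) (g'' := 0) c y
    (by fun_prop) (fun s => by simpa using (hasDerivAt_id s).const_mul a) (hasDerivAt_const _ _)
  simpa using h

lemma laplacian_mul_exp_norm_sq (ε α β : ℝ) (c y : E) :
    Laplacian.laplacian (fun x : E => ε * (Real.exp (-α * ‖x - c‖ ^ 2) - β)) y =
      ε * (Real.exp (-α * ‖y - c‖ ^ 2) *
        (4 * α ^ 2 * ‖y - c‖ ^ 2 - 2 * Module.finrank ℝ E * α)) := by
  have hE : ∀ s : ℝ, HasDerivAt (fun s : ℝ => Real.exp (-α * s)) (Real.exp (-α * s) * -α) s :=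
    fun s => by simpa using ((hasDerivAt_id s).const_mul (-α)).exp
  have h := laplacian_radial (g := fun s => ε * (Real.exp (-α * s) - β))
    (g' := fun s => ε * (Real.exp (-α * s) * -α)) c y (by fun_prop)
    (fun s => ((hE s).sub_const β).const_mul ε) (((hE _).mul_const (-α)).const_mul ε)
  rw [h]
  ring

lemma laplacian_inner_sub {V : Type*} [NormedAddCommGroup V] [InnerProductSpace ℝ V]
    {u : E → V} (hu : ContDiff ℝ 2 u) (a b : V) (x : E) :
    Laplacian.laplacian (fun y => inner ℝ a (u y - b)) x =
      inner ℝ a (Laplacian.laplacian u x) := by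
  have h1 := (hu.sub contDiff_const : ContDiff ℝ 2 (u - fun _ : E => b)).contDiffAt (x := x)
    |>.laplacian_CLM_comp_left (l := innerSL ℝ a)
  have h2 : Laplacian.laplacian (fun y => u y - b) x = Laplacian.laplacian u x :=
    (hu.contDiffAt.laplacian_sub contDiff_const.contDiffAt).trans (by simp)
  rw [Function.comp_apply, h2] at h1
  exact h1

end Calculus

/-! ### A strong maximum principle in the barrier sense -/

section StrongMaximumPrinciple

variable {E : Type*} [NormedAddCommGroup E] [InnerProductSpace ℝ E] [FiniteDimensional ℝ E]

/-- Strong minimum principle for a continuous `q ≥ 0` with `Δq ≤ L q` in the barrier sense of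
Calabi: at each point `q` is touched from above by a `C²` function `φ` with `Δφ ≤ L q` there. If
`q` vanishes somewhere, it vanishes identically. The proof is Hopf's: on a ball on which `q > 0`
and whose boundary carries a zero of `q`, the function `exp (-α |x - c|²)` is a strict subsolution
off the half ball, so `q` grows at least linearly into the ball, while its upper barrier at the
zero is flat. -/
theorem eq_zero_of_laplacian_le_barrier {q : E → ℝ} {L : ℝ} (hL : 0 ≤ L) (hq : Continuous q)
    (hq0 : ∀ x, 0 ≤ q x)
    (hbar : ∀ x, ∃ φ : E → ℝ, ContDiff ℝ 2 φ ∧ (∀ y, q y ≤ φ y) ∧ φ x = q x ∧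
      Laplacian.laplacian φ x ≤ L * q x)
    {x₀ : E} (hx₀ : q x₀ = 0) (c : E) : q c = 0 := by
  by_contra hc
  set Z : Set E := {x | q x = 0} with hZ
  have hZc : IsClosed Z := isClosed_eq hq continuous_const
  obtain ⟨x₁, hx₁, hdist⟩ := hZc.exists_infDist_eq_dist ⟨x₀, hx₀⟩ c
  have hx₁' : q x₁ = 0 := hx₁
  set R := dist c x₁ with hR
  have hRpos : 0 < R := dist_pos.2 (by rintro rfl; exact hc hx₁')
  have hpos : ∀ x, ‖x - c‖ < R → 0 < q x := by
    intro x hx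
    refine (hq0 x).lt_of_ne' fun h0 => ?_
    have : infDist c Z ≤ dist c x := infDist_le_dist_of_mem h0
    rw [hdist, dist_comm c x, dist_eq_norm] at this
    linarith
  obtain ⟨ε, hε, hqε⟩ := (isCompact_closedBall c (R / 2)).exists_forall_le' (a := 0)
    hq.continuousOn (fun x hx => hpos x (by
      rw [mem_closedBall, dist_eq_norm] at hx; linarith))
  set N : ℝ := (Module.finrank ℝ E : ℝ) with hN
  have hN0 : 0 ≤ N := Nat.cast_nonneg _
  -- `α` is chosen so that `α * (α * R ^ 2 - 2 * N) > L`
  set α : ℝ := 1 + (2 * N + L + 1) / R ^ 2 with hα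
  have hα1 : 1 ≤ α := by
    have : 0 ≤ (2 * N + L + 1) / R ^ 2 := by positivity
    linarith
  have hαR : L + 1 ≤ α * R ^ 2 - 2 * N := by
    have : α * R ^ 2 = R ^ 2 + (2 * N + L + 1) := by rw [hα]; field_simp
    nlinarith [sq_nonneg R]
  set β := Real.exp (-α * R ^ 2) with hβ
  set ψ : E → ℝ := fun x => ε * (Real.exp (-α * ‖x - c‖ ^ 2) - β) with hψ
  have hψC : ContDiff ℝ 2 ψ := by
    have : ContDiff ℝ 2 (fun x : E => ‖x - c‖ ^ 2) :=
      (contDiff_id.sub contDiff_const).norm_sq ℝ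
    fun_prop
  have hcmp : ∀ x ∈ closedBall c R, ψ x ≤ q x := by
    obtain ⟨y, hy, hmin⟩ := (isCompact_closedBall c R).exists_isMinOn
      ⟨c, mem_closedBall_self hRpos.le⟩ (hq.sub hψC.continuous).continuousOn
    suffices h : ψ y ≤ q y by
      intro x hx
      have : q y - ψ y ≤ q x - ψ x := hmin hx
      linarith
    by_contra! hlt
    have hψy : 0 < ψ y := (hq0 y).trans_lt hlt
    have hexp : β < Real.exp (-α * ‖y - c‖ ^ 2) := by
      have := (mul_pos_iff_of_pos_left hε).1 hψy
      linarith
    have hyR : ‖y - c‖ < R := by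
      have h1 : -α * R ^ 2 < -α * ‖y - c‖ ^ 2 := Real.exp_lt_exp.1 hexp
      have h2 : ‖y - c‖ ^ 2 < R ^ 2 := by nlinarith
      exact lt_of_pow_lt_pow_left₀ 2 hRpos.le h2
    have hyR2 : R / 2 < ‖y - c‖ := by
      by_contra! hle
      have h1 : ε ≤ q y := hqε y (by rwa [mem_closedBall, dist_eq_norm])
      have h2 : Real.exp (-α * ‖y - c‖ ^ 2) ≤ 1 :=
        Real.exp_le_one_iff.2 (by nlinarith [sq_nonneg ‖y - c‖])
      have h3 : 0 < β := Real.exp_pos _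
      have h4 : ψ y ≤ ε * 1 := mul_le_mul_of_nonneg_left (by linarith) hε.le
      linarith
    obtain ⟨φ, hφC, hφ, hφy, hΔ⟩ := hbar y
    have hloc : IsLocalMin (φ - ψ) y := by
      filter_upwards [isOpen_ball.mem_nhds (show y ∈ ball c R by
        rwa [mem_ball, dist_eq_norm])] with x hx
      have h1 : q y - ψ y ≤ q x - ψ x := hmin (ball_subset_closedBall hx)
      have h2 := hφ x
      simp only [Pi.sub_apply]
      linarith
    have hΔ' := laplacian_le_of_isLocalMin_sub hφC hψC hloc
    rw [hψ, laplacian_mul_exp_norm_sq, ← hN] at hΔ'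
    have hs : R ^ 2 ≤ 4 * ‖y - c‖ ^ 2 := by nlinarith
    have h5 : L + 1 ≤ 4 * α ^ 2 * ‖y - c‖ ^ 2 - 2 * N * α := by
      have h6 : α ^ 2 * R ^ 2 ≤ α ^ 2 * (4 * ‖y - c‖ ^ 2) :=
        mul_le_mul_of_nonneg_left hs (sq_nonneg α)
      have h7 : 1 * (L + 1) ≤ α * (α * R ^ 2 - 2 * N) :=
        mul_le_mul hα1 hαR (by linarith) (by linarith)
      nlinarith
    have hX : 0 < Real.exp (-α * ‖y - c‖ ^ 2) := Real.exp_pos _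
    set X := Real.exp (-α * ‖y - c‖ ^ 2) with hXdef
    have h8 : ε * (X * (L + 1)) ≤ L * q y :=
      (mul_le_mul_of_nonneg_left (mul_le_mul_of_nonneg_left h5 hX.le) hε.le).trans
        (hΔ'.trans hΔ)
    have h9 : L * q y ≤ L * (ε * X) := by
      refine mul_le_mul_of_nonneg_left (hlt.le.trans ?_) hL
      exact mul_le_mul_of_nonneg_left (by linarith [Real.exp_pos (-α * R ^ 2)]) hε.le
    nlinarith [mul_pos hε hX]
  obtain ⟨φ, hφC, hφ, hφ1, -⟩ := hbar x₁
  set e := c - x₁ with he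
  have hderiv : HasDerivAt (fun t : ℝ => φ (x₁ + t • e)) 0 0 := by
    have hmin : IsLocalMin (fun t : ℝ => φ (x₁ + t • e)) 0 :=
      Eventually.of_forall fun t => by
        simpa [hφ1, hx₁'] using (hq0 _).trans (hφ (x₁ + t • e))
    have hd : DifferentiableAt ℝ (fun t : ℝ => φ (x₁ + t • e)) 0 :=
      (contDiff_line hφC x₁ e).differentiable (by norm_num) 0
    simpa [hmin.deriv_eq_zero] using hd.hasDerivAt
  -- the linear growth rate of the barrier into the ball
  set κ := ε * (β * (α * R ^ 2)) with hκ
  have hβpos : 0 < β := Real.exp_pos _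
  have hκpos : 0 < κ := by positivity
  have hgrow : ∀ t ∈ Icc (0 : ℝ) 1, κ * t ≤ φ (x₁ + t • e) := by
    intro t ht
    have hnorm : ‖x₁ + t • e - c‖ = (1 - t) * R := by
      have : x₁ + t • e - c = (1 - t) • (x₁ - c) := by rw [he]; module
      rw [this, norm_smul, Real.norm_of_nonneg (by linarith [ht.2]), hR, dist_comm, dist_eq_norm]
    have hmem : x₁ + t • e ∈ closedBall c R := by
      rw [mem_closedBall, dist_eq_norm, hnorm]
      nlinarith [ht.1]
    refine le_trans ?_ ((hcmp _ hmem).trans (hφ _))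
    have hexp : β * (1 + (α * R ^ 2 * (1 - (1 - t) ^ 2))) ≤ Real.exp (-α * ((1 - t) * R) ^ 2) := by
      have h1 : Real.exp (-α * ((1 - t) * R) ^ 2) =
          β * Real.exp (α * R ^ 2 * (1 - (1 - t) ^ 2)) := by
        rw [hβ, ← Real.exp_add]; ring_nf
      rw [h1]
      refine mul_le_mul_of_nonneg_left ?_ hβpos.le
      linarith [Real.add_one_le_exp (α * R ^ 2 * (1 - (1 - t) ^ 2))]
    simp only [hψ, hnorm]
    rw [hκ, mul_assoc]
    refine mul_le_mul_of_nonneg_left ?_ hε.le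
    have h2 : t ≤ 1 - (1 - t) ^ 2 := by nlinarith [ht.1, ht.2]
    have h3 : β * (α * R ^ 2) * t ≤ β * (α * R ^ 2) * (1 - (1 - t) ^ 2) :=
      mul_le_mul_of_nonneg_left h2 (by positivity)
    linarith
  have hsmall := (hasDerivAt_iff_isLittleO_nhds_zero.1 hderiv).def (half_pos hκpos)
  have hev : ∀ᶠ t : ℝ in 𝓝[>] 0, False := by
    filter_upwards [nhdsWithin_le_nhds hsmall, Ioo_mem_nhdsGT (zero_lt_one' ℝ)] with t h1 h2
    have h3 := hgrow t ⟨h2.1.le, h2.2.le⟩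
    simp only [zero_add, zero_smul, add_zero, smul_zero, sub_zero, hφ1, hx₁',
      Real.norm_eq_abs, abs_of_pos h2.1] at h1
    have h4 := (le_abs_self _).trans h1
    nlinarith [mul_pos hκpos h2.1]
  exact hev.exists.elim fun _ h => h

end StrongMaximumPrinciple

/-! ### Supporting normals, nearest boundary points and interior balls -/

section Convex

variable {V : Type*} [NormedAddCommGroup V] [InnerProductSpace ℝ V]

/-- `ν` is a unit outward normal of a supporting hyperplane of `D` at `w`, that is, `D` lies in the
half-space `{z | ⟪ν, z - w⟫ ≤ 0}`. -/
def IsSupportingNormal (D : Set V) (w ν : V) : Prop :=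
  ‖ν‖ = 1 ∧ ∀ z ∈ closure D, inner ℝ ν (z - w) ≤ 0

lemma exists_isSupportingNormal [CompleteSpace V] {D : Set V} (hopen : IsOpen D)
    (hne : D.Nonempty) (hconv : Convex ℝ D) {w : V} (hw : w ∉ D) :
    ∃ ν, IsSupportingNormal D w ν := by
  obtain ⟨f, hf⟩ := geometric_hahn_banach_open_point hconv hopen hw
  set a := (InnerProductSpace.toDual ℝ V).symm f with ha
  have hfa : ∀ z, inner ℝ a z = f z := fun z => InnerProductSpace.toDual_symm_apply
  have ha0 : a ≠ 0 := by
    rintro h0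
    obtain ⟨z, hz⟩ := hne
    have := hf z hz
    simp [← hfa, h0] at this
  refine ⟨‖a‖⁻¹ • a, by simp [norm_smul, ha0], fun z hz => ?_⟩
  have hcl : closure D ⊆ {z | inner ℝ a (z - w) ≤ 0} := by
    refine closure_minimal (fun z hz => ?_) (isClosed_le (by fun_prop) continuous_const)
    have := hf z hz
    rw [mem_ofPred_eq, inner_sub_right, hfa, hfa]
    linarith
  rw [real_inner_smul_left]
  exact mul_nonpos_of_nonneg_of_nonpos (by positivity) (hcl hz)

namespace IsSupportingNormal

variable {D : Set V} {w ν : V}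

lemma inner_self (h : IsSupportingNormal D w ν) : inner ℝ ν ν = 1 := by
  rw [real_inner_self_eq_norm_sq, h.1, one_pow]

/-- The point at distance `t` from `w` in an outward normal direction has `w` as its nearest point
of `∂D`. -/
lemma infDist_frontier_add_smul (h : IsSupportingNormal D w ν) (hw : w ∈ frontier D) {t : ℝ}
    (ht : 0 < t) :
    w + t • ν ∉ closure D ∧ dist (w + t • ν) w = infDist (w + t • ν) (frontier D) := by
  have hd : dist (w + t • ν) w = t := by
    simp [dist_eq_norm, norm_smul, h.1, abs_of_pos ht]
  constructor
  · intro hmem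
    have := h.2 _ hmem
    rw [add_sub_cancel_left, inner_smul_right, h.inner_self] at this
    linarith
  · refine le_antisymm ?_ (infDist_le_dist_of_mem hw)
    refine (le_infDist ⟨w, hw⟩).2 fun z hz => ?_
    rw [hd, dist_eq_norm]
    have h1 : inner ℝ ν (w + t • ν - z) ≤ ‖w + t • ν - z‖ := by
      simpa [h.1] using real_inner_le_norm ν (w + t • ν - z)
    have h2 := h.2 z (frontier_subset_closure hz)
    have h3 : w + t • ν - z = t • ν - (z - w) := by abel
    rw [h3, inner_sub_right, inner_smul_right, h.inner_self, ← h3] at h1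
    linarith

lemma inner_lt_zero_of_mem_interior (h : IsSupportingNormal D w ν) {z : V}
    (hz : z ∈ interior (closure D)) : inner ℝ ν (z - w) < 0 := by
  have hc : ContinuousAt (fun t : ℝ => z + t • ν) 0 := by fun_prop
  have hev : ∀ᶠ t : ℝ in 𝓝 0, z + t • ν ∈ closure D :=
    hc.eventually_mem (by simpa using mem_interior_iff_mem_nhds.1 hz)
  obtain ⟨t, ht, ht0⟩ := ((hev.filter_mono nhdsWithin_le_nhds).and
    (self_mem_nhdsWithin : Ioi (0 : ℝ) ∈ 𝓝[>] 0)).exists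
  have := h.2 _ ht
  rw [add_sub_right_comm, inner_add_right, inner_smul_right, h.inner_self] at this
  have ht0' : (0 : ℝ) < t := ht0
  linarith

/-- If a closed ball inside `closure D` passes through `w`, then its centre lies on the inward
normal at `w`. -/
lemma eq_sub_smul_of_closedBall_subset (h : IsSupportingNormal D w ν) {c : V} {r : ℝ}
    (hr : 0 ≤ r) (hwc : dist w c = r) (hball : closedBall c r ⊆ closure D) : c = w - r • ν := by
  have hmem : c + r • ν ∈ closure D := hball (by
    simp [dist_eq_norm, norm_smul, h.1, abs_of_nonneg hr])
  have h1 := h.2 _ hmem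
  rw [add_sub_right_comm, inner_add_right, inner_smul_right, h.inner_self] at h1
  have h2 : ‖c - w‖ = r := by rw [← dist_eq_norm, dist_comm, hwc]
  have h3 : ‖c - w + r • ν‖ ^ 2 ≤ 0 := by
    rw [norm_add_sq_real, h2, norm_smul, h.1, inner_smul_right, real_inner_comm,
      Real.norm_of_nonneg hr]
    nlinarith
  have h4 : c - w + r • ν = 0 := by
    rw [← norm_eq_zero]
    exact pow_eq_zero_iff (two_ne_zero) |>.1 (le_antisymm h3 (sq_nonneg _))
  rw [← sub_eq_zero, ← h4]
  abel

/-- Cocoercivity of the normal map: if the ball of radius `r` touches `∂D` from inside at the second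
point, the variation of the normal is controlled by the height over the tangent plane at the
first. -/
lemma half_mul_norm_sub_sq_le (h : IsSupportingNormal D w ν) {w' ν' c : V} {r : ℝ}
    (h' : IsSupportingNormal D w' ν') (hr : 0 ≤ r) (hwc : dist w' c = r)
    (hball : closedBall c r ⊆ closure D) :
    r / 2 * ‖ν - ν'‖ ^ 2 ≤ inner ℝ ν (w - w') := by
  have hc := h'.eq_sub_smul_of_closedBall_subset hr hwc hball
  have hmem : c + r • ν ∈ closure D := hball (by
    simp [dist_eq_norm, norm_smul, h.1, abs_of_nonneg hr])
  have h1 := h.2 _ hmem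
  have h2 : c + r • ν - w = r • ν - r • ν' - (w - w') := by rw [hc]; abel
  rw [h2, inner_sub_right, inner_sub_right, inner_smul_right, inner_smul_right, h.inner_self] at h1
  rw [norm_sub_sq_real, h.1, h'.1]
  nlinarith

end IsSupportingNormal

/-- The ball around a point of `closure D` that reaches to the boundary stays in `closure D`. -/
lemma closedBall_infDist_frontier_subset {D : Set V} {v : V} (hv : v ∈ closure D) :
    closedBall v (infDist v (frontier D)) ⊆ closure D := by
  rcases eq_or_ne (infDist v (frontier D)) 0 with h0 | h0
  · simpa [h0] using hv
  rw [← closure_ball v h0]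
  refine closure_minimal ?_ isClosed_closure
  have hdisj : Disjoint (ball v (infDist v (frontier D))) (frontier D) :=
    disjoint_ball_infDist
  intro z hz
  by_contra hzD
  have hvb : v ∈ ball v (infDist v (frontier D)) :=
    mem_ball_self (infDist_nonneg.lt_of_ne' h0)
  have hpre : IsPreconnected (ball v (infDist v (frontier D))) := (convex_ball v _).isPreconnected
  have hint : ∀ y ∈ ball v (infDist v (frontier D)), y ∈ closure D → y ∈ interior D :=
    fun y hy hyD => by_contra fun h => disjoint_left.1 hdisj hy ⟨hyD, h⟩
  obtain ⟨y, -, hy1, hy2⟩ := hpre (interior D) (closure D)ᶜ isOpen_interior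
    isClosed_closure.isOpen_compl (fun y hy => (em (y ∈ closure D)).imp_left (hint y hy))
    ⟨v, hvb, hint v hvb hv⟩ ⟨z, hz, hzD⟩
  exact hy2 (interior_subset.trans subset_closure hy1)

lemma IsSupportingNormal.infDist_frontier_le {D : Set V} {w ν v : V}
    (h : IsSupportingNormal D w ν) (hv : v ∈ closure D) :
    infDist v (frontier D) ≤ inner ℝ ν (w - v) := by
  have hmem : v + infDist v (frontier D) • ν ∈ closure D :=
    closedBall_infDist_frontier_subset hv (by
      simp [dist_eq_norm, norm_smul, h.1, abs_of_nonneg infDist_nonneg])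
  have h1 := h.2 _ hmem
  have h2 : v + infDist v (frontier D) • ν - w = infDist v (frontier D) • ν - (w - v) := by abel
  rw [h2, inner_sub_right, inner_smul_right, h.inner_self] at h1
  linarith

/-- Existence of the metric projection onto `closure D`, with its variational inequality and the
fact that it is also a nearest point of `∂D`. -/
lemma exists_projection [CompleteSpace V] {D : Set V} (hne : D.Nonempty) (hconv : Convex ℝ D)
    {v : V} (hv : v ∉ closure D) :
    ∃ w ∈ frontier D, dist v w = infDist v (closure D) ∧ dist v w = infDist v (frontier D) ∧
      ∀ z ∈ closure D, inner ℝ (v - w) (z - w) ≤ 0 := by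
  obtain ⟨w, hw, hmin⟩ := exists_norm_eq_iInf_of_complete_convex (K := closure D) hne.closure
    isClosed_closure.isComplete hconv.closure v
  have hvar := (norm_eq_iInf_iff_real_inner_le_zero hconv.closure hw).1 hmin
  have hd : dist v w = infDist v (closure D) := by
    rw [infDist_eq_iInf, dist_eq_norm, hmin]
    simp_rw [dist_eq_norm]
  have hfr : w ∈ frontier D := by
    refine ⟨hw, fun hint => ?_⟩
    have hc : ContinuousAt (fun t : ℝ => w + t • (v - w)) 0 := by fun_prop
    have hev : ∀ᶠ t : ℝ in 𝓝 0, w + t • (v - w) ∈ D :=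
      hc.eventually_mem (by simpa using mem_interior_iff_mem_nhds.1 hint)
    obtain ⟨t, ht, ht0⟩ := ((hev.filter_mono nhdsWithin_le_nhds).and
      (self_mem_nhdsWithin : Ioi (0 : ℝ) ∈ 𝓝[>] 0)).exists
    have h1 := hvar _ (subset_closure ht)
    rw [add_sub_cancel_left, inner_smul_right, real_inner_self_eq_norm_sq] at h1
    have hvw : 0 < ‖v - w‖ := norm_pos_iff.2 (sub_ne_zero.2 (by rintro rfl; exact hv hw))
    have ht0' : (0 : ℝ) < t := ht0
    have : 0 < t * ‖v - w‖ ^ 2 := by positivity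
    linarith
  refine ⟨w, hfr, hd, le_antisymm ?_ (infDist_le_dist_of_mem hfr), hvar⟩
  rw [hd]
  exact infDist_le_infDist_of_subset frontier_subset_closure ⟨w, hfr⟩

/-- On the boundary, `F` does not point strictly inwards. -/
lemma IsSupportingNormal.inner_nonneg {D : Set V} {F : V → V} (hF : Continuous F)
    (hFD : ∀ v ∉ closure D, ∀ v₀ ∈ frontier D,
      dist v v₀ = infDist v (frontier D) → 0 < inner ℝ (v - v₀) (F v))
    {w ν : V} (hw : w ∈ frontier D) (h : IsSupportingNormal D w ν) : 0 ≤ inner ℝ ν (F w) := by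
  have hc : Continuous fun t : ℝ => inner ℝ ν (F (w + t • ν)) := by fun_prop
  have hlim : Tendsto (fun t : ℝ => inner ℝ ν (F (w + t • ν))) (𝓝[>] 0) (𝓝 (inner ℝ ν (F w))) := by
    have := (hc.tendsto 0).mono_left (nhdsWithin_le_nhds (s := Ioi 0))
    simpa using this
  refine ge_of_tendsto hlim ?_
  filter_upwards [self_mem_nhdsWithin] with t (ht : 0 < t)
  obtain ⟨h1, h2⟩ := h.infDist_frontier_add_smul hw ht
  have h3 := hFD _ h1 w hw h2
  rw [add_sub_cancel_left, real_inner_smul_left] at h3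
  exact ((mul_pos_iff_of_pos_left ht).1 h3).le

/-- Descent lemma: a `C²` function lies locally below its tangent plane plus a quadratic. -/
lemma exists_le_add_fderiv_add_sq {G : V → ℝ} (hG : ContDiff ℝ 2 G) (p : V) :
    ∃ ρ > 0, ∃ K : ℝ, 0 ≤ K ∧ ∀ v ∈ ball p ρ, ∀ w ∈ ball p ρ,
      G v ≤ G w + fderiv ℝ G w (v - w) + K * ‖v - w‖ ^ 2 := by
  have hd : ContDiff ℝ 1 (fderiv ℝ G) := hG.fderiv_right (by norm_num)
  obtain ⟨K, t, ht, hK⟩ := hd.contDiffAt (x := p) |>.exists_lipschitzOnWith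
  obtain ⟨ρ, hρ, hsub⟩ := Metric.mem_nhds_iff.1 ht
  refine ⟨ρ, hρ, K, K.2, fun v hv w hw => ?_⟩
  have hseg : segment ℝ w v ⊆ ball p ρ := (convex_ball p ρ).segment_subset hw hv
  have hb := (convex_segment (𝕜 := ℝ) w v).norm_image_sub_le_of_norm_hasFDerivWithin_le'
    (f := G) (f' := fderiv ℝ G) (φ := fderiv ℝ G w) (C := K * ‖v - w‖)
    (fun z _ => (hG.differentiable (by norm_num) z).hasFDerivAt.hasFDerivWithinAt)
    (fun z hz => by
      have h1 := hK.dist_le_mul z (hsub (hseg hz)) w (hsub hw)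
      rw [dist_eq_norm, dist_eq_norm] at h1
      refine h1.trans (mul_le_mul_of_nonneg_left ?_ K.2)
      simpa [dist_eq_norm] using norm_sub_le_of_mem_segment hz)
    (left_mem_segment ℝ w v) (right_mem_segment ℝ w v)
  have := (le_abs_self _).trans hb
  nlinarith

end Convex

/-- A set with `C²` boundary satisfies, locally uniformly, an interior ball condition. -/
lemma HasC2Boundary.exists_interior_ball {m : ℕ} {D : Set (EuclideanSpace ℝ (Fin m))}
    (hD : HasC2Boundary D) {p : EuclideanSpace ℝ (Fin m)} (hp : p ∈ frontier D) :
    ∃ ρ > 0, ∃ r > 0, ∀ w ∈ frontier D ∩ ball p ρ, ∃ c, dist w c = r ∧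
      closedBall c r ⊆ closure D := by
  obtain ⟨r₀, hr₀, e, he, γ, hγ, hDγ⟩ := hD p hp
  -- a defining function: `D` is `{G < 0}` near `p`, and `G` has slope `-1` in the direction `e`
  set G : EuclideanSpace ℝ (Fin m) → ℝ := fun x => γ (x - inner ℝ e x • e) - inner ℝ e x with hGdef
  have hG : ContDiff ℝ 2 G := by
    have hin : ContDiff ℝ 2 fun x : EuclideanSpace ℝ (Fin m) => inner ℝ e x :=
      contDiff_const.inner ℝ contDiff_id
    exact (hγ.comp (contDiff_id.sub (hin.smul contDiff_const))).sub hin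
  have hDG : ∀ x ∈ ball p r₀, x ∈ D ↔ G x < 0 := fun x hx => by
    rw [hDγ x hx, hGdef, sub_neg]
  have hee : inner ℝ e e = 1 := by rw [real_inner_self_eq_norm_sq, he, one_pow]
  have hslope : ∀ w, fderiv ℝ G w e = -1 := by
    intro w
    have h1 := deriv_line hG w e 0
    have h2 : (fun s : ℝ => G (w + s • e)) = fun s => G w - s := by
      funext s
      have h3 : w + s • e - inner ℝ e (w + s • e) • e = w - inner ℝ e w • e := by
        rw [inner_add_right, inner_smul_right, hee]; module
      simp only [hGdef, h3]
      rw [inner_add_right, inner_smul_right, hee]; ring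
    rw [h2] at h1
    simpa using h1.symm
  obtain ⟨ρ₀, hρ₀, K, hK, hquad⟩ := exists_le_add_fderiv_add_sq hG p
  set ρ := min r₀ ρ₀ / 2 with hρ
  have hρpos : 0 < ρ := by positivity
  have hρr : 2 * ρ ≤ r₀ := by rw [hρ]; linarith [min_le_left r₀ ρ₀]
  have hρρ : 2 * ρ ≤ ρ₀ := by rw [hρ]; linarith [min_le_right r₀ ρ₀]
  set r := min (ρ / 4) (1 / (4 * (K + 1))) with hr
  have hrpos : 0 < r := by positivity
  have hr1 : r ≤ ρ / 4 := min_le_left _ _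
  have hr2 : r * (4 * (K + 1)) ≤ 1 := by
    have h4 : r ≤ 1 / (4 * (K + 1)) := min_le_right _ _
    rwa [le_div_iff₀ (by positivity)] at h4
  refine ⟨ρ, hρpos, r, hrpos, fun w ⟨hw, hwp⟩ => ?_⟩
  have hwp' : dist w p < ρ := hwp
  have hGw : G w ≤ 0 := by
    have hcl : w ∈ closure (D ∩ ball p r₀) := by
      have := isOpen_ball.inter_closure (s := ball p r₀) (t := D)
        ⟨mem_ball.2 (by linarith), frontier_subset_closure hw⟩
      rwa [inter_comm] at this
    exact closure_minimal (fun z hz => ((hDG z hz.2).1 hz.1).le)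
      (isClosed_le hG.continuous continuous_const) hcl
  set N := (InnerProductSpace.toDual ℝ _).symm (fderiv ℝ G w) with hNdef
  have hN : ∀ z, inner ℝ N z = fderiv ℝ G w z := fun z => InnerProductSpace.toDual_symm_apply
  have hN1 : 1 ≤ ‖N‖ := by
    have h1 := abs_real_inner_le_norm N e
    rw [hN, hslope, he] at h1
    simpa using h1
  have hNpos : 0 < ‖N‖ := by linarith
  set a := ‖N‖⁻¹ • N with ha
  have han : ‖a‖ = 1 := by rw [ha, norm_smul]; simp [hNpos.ne']
  have hNa : N = ‖N‖ • a := by rw [ha, smul_smul, mul_inv_cancel₀ hNpos.ne', one_smul]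
  refine ⟨w - r • a, ?_, fun v hv => ?_⟩
  · simp [norm_smul, han, abs_of_pos hrpos]
  rcases eq_or_ne v w with rfl | hvw
  · exact frontier_subset_closure hw
  apply subset_closure
  have hvc : ‖v - w + r • a‖ ≤ r := by
    rw [mem_closedBall, dist_eq_norm] at hv
    rwa [sub_sub_eq_add_sub, add_sub_right_comm] at hv
  have hvw1 : ‖v - w‖ ≤ 2 * r := by
    have h1 := norm_sub_le (v - w + r • a) (r • a)
    rw [add_sub_cancel_right, norm_smul, han, Real.norm_of_nonneg hrpos.le] at h1
    linarith
  have hvp : dist v p < 2 * ρ := by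
    have := dist_triangle v w p
    rw [dist_eq_norm v w] at this
    linarith
  have hsq : ‖v - w‖ ^ 2 + 2 * r * inner ℝ a (v - w) ≤ 0 := by
    have h1 : ‖v - w + r • a‖ ^ 2 ≤ r ^ 2 := pow_le_pow_left₀ (norm_nonneg _) hvc 2
    rw [norm_add_sq_real, norm_smul, han, inner_smul_right, real_inner_comm,
      Real.norm_of_nonneg hrpos.le] at h1
    linarith
  rw [hDG v (mem_ball.2 (by linarith))]
  have hq := hquad v (mem_ball.2 (by linarith)) w (mem_ball.2 (by linarith))
  rw [← hN, hNa, real_inner_smul_left] at hq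
  have hd : 0 < ‖v - w‖ ^ 2 := by
    have := norm_pos_iff.2 (sub_ne_zero.2 hvw)
    positivity
  set A := inner ℝ a (v - w) with hA
  have hA0 : A ≤ 0 := by nlinarith
  have h1 : ‖N‖ * A ≤ A := by nlinarith
  have h2 : A + K * ‖v - w‖ ^ 2 < 0 := by
    -- multiply by `2 * r` and use `2 * r * K < 1`
    have h3 : 2 * r * (A + K * ‖v - w‖ ^ 2) < 0 := by nlinarith
    exact (pos_iff_neg_of_mul_neg h3).1 (by positivity)
  linarith

/-! ### Entire solutions stay in the closed domain -/

section Solutions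

variable {E V : Type*} [NormedAddCommGroup E] [InnerProductSpace ℝ E] [FiniteDimensional ℝ E]
  [NormedAddCommGroup V] [InnerProductSpace ℝ V] [FiniteDimensional ℝ V]

/-- A bounded entire solution takes values in `closure D`. The function
`dist (u x, closure D) - ε |x - x₀|²` attains its maximum, where the affine function supporting the
distance touches it from below; since the outward component of `F` is bounded below by a positive
constant at positive bounded distance from `D`, this is impossible for small `ε`. -/
theorem mem_closure_of_laplacian_eq {D : Set V} (hne : D.Nonempty) (hconv : Convex ℝ D)
    {F : V → V} (hF : Continuous F)
    (hFD : ∀ v ∉ closure D, ∀ v₀ ∈ frontier D,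
      dist v v₀ = infDist v (frontier D) → 0 < inner ℝ (v - v₀) (F v))
    {u : E → V} (hu : ContDiff ℝ 2 u) {C : ℝ} (hC : ∀ x, ‖u x‖ ≤ C)
    (heq : ∀ x, Laplacian.laplacian u x = F (u x)) (x₀ : E) : u x₀ ∈ closure D := by
  by_contra hx₀
  set d : V → ℝ := fun v => infDist v (closure D) with hd
  have hdc : Continuous d := continuous_infDist_pt _
  have hpos : ∀ v, 0 < d v ↔ v ∉ closure D := fun v => by
    rw [isClosed_closure.notMem_iff_infDist_pos hne.closure]
  obtain ⟨p, hp⟩ := hne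
  have hdB : ∀ x, d (u x) ≤ C + ‖p‖ := fun x =>
    (infDist_le_dist_of_mem (subset_closure hp)).trans <| by
      rw [dist_eq_norm]
      exact (norm_sub_le _ _).trans (by linarith [hC x])
  set μ := d (u x₀) with hμ
  have hμpos : 0 < μ := (hpos _).2 hx₀
  -- pairs of a value at distance at least `μ` from `D` and a nearest point of `closure D`
  set S : Set (V × V) := {z | z.1 ∈ closedBall 0 C ∧ z.2 ∈ frontier D ∧ dist z.1 z.2 = d z.1 ∧
    dist z.1 z.2 = infDist z.1 (frontier D) ∧ μ ≤ d z.1} with hS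
  have hScl : IsClosed S := by
    refine (isClosed_closedBall.preimage continuous_fst).inter
      ((isClosed_frontier.preimage continuous_snd).inter ?_)
    refine (isClosed_eq continuous_dist (hdc.comp continuous_fst)).inter ?_
    exact (isClosed_eq continuous_dist ((continuous_infDist_pt _).comp continuous_fst)).inter
      (isClosed_le continuous_const (hdc.comp continuous_fst))
  have hSc : IsCompact S := by
    refine ((isCompact_closedBall (0 : V) C).prod
      (isCompact_closedBall (0 : V) (C + (C + ‖p‖)))).of_isClosed_subset hScl ?_
    rintro ⟨v, w⟩ ⟨h1, h2, h3, -, -⟩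
    refine ⟨h1, ?_⟩
    have hv : ‖v‖ ≤ C := by simpa using h1
    have h4 : d v ≤ dist v p := infDist_le_dist_of_mem (subset_closure hp)
    have h5 : dist v p ≤ ‖v‖ + ‖p‖ := by rw [dist_eq_norm]; exact norm_sub_le _ _
    have h6 : ‖w‖ ≤ ‖v‖ + dist v w := by
      rw [dist_eq_norm]; exact norm_le_norm_add_norm_sub _ _
    simp only [mem_closedBall, dist_zero_right]
    have h3' : dist v w = d v := h3
    linarith
  obtain ⟨κ, hκ, hκS⟩ := hSc.exists_forall_le' (a := 0)
    (f := fun z : V × V => inner ℝ (z.1 - z.2) (F z.1)) (by fun_prop)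
    (fun z hz => hFD z.1 ((hpos _).1 (hμpos.trans_le hz.2.2.2.2)) z.2 hz.2.1 hz.2.2.2.1)
  set B := C + ‖p‖ with hB
  have hBpos : 0 < B := hμpos.trans_le (hdB x₀)
  set N : ℝ := (Module.finrank ℝ E : ℝ) with hN
  have hN0 : 0 ≤ N := Nat.cast_nonneg _
  set ε := κ / (2 * (N + 1) * B) with hε
  have hεpos : 0 < ε := by positivity
  -- the penalised distance attains its maximum at some `y`
  set g : E → ℝ := fun x => d (u x) - ε * ‖x - x₀‖ ^ 2 with hg
  have hgc : Continuous g := (hdc.comp hu.continuous).sub (by fun_prop)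
  obtain ⟨y, hy⟩ : ∃ y, ∀ x, g x ≤ g y := by
    refine hgc.exists_forall_ge' x₀ ?_
    have h0 : g x₀ = μ := by simp [hg, hμ]
    filter_upwards [(isCompact_closedBall x₀ √(B / ε)).compl_mem_cocompact] with x hx
    rw [mem_compl_iff, mem_closedBall, not_le, dist_eq_norm,
      Real.sqrt_lt (by positivity) (norm_nonneg _), div_lt_iff₀ hεpos] at hx
    have := hdB x
    rw [h0]
    simp only [hg]
    linarith
  have hyμ : μ ≤ d (u y) := by
    have h1 := hy x₀
    simp only [hg, sub_self, norm_zero] at h1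
    have h2 : 0 ≤ ε * ‖y - x₀‖ ^ 2 := by positivity
    rw [hμ]
    linarith
  obtain ⟨w, hw, hdw, hdw', hvar⟩ :=
    exists_projection ⟨p, hp⟩ hconv ((hpos _).1 (hμpos.trans_le hyμ))
  have hκy : κ ≤ inner ℝ (u y - w) (F (u y)) :=
    hκS (u y, w) ⟨by simpa using hC y, hw, hdw, hdw', hyμ⟩
  have hvw : ‖u y - w‖ = d (u y) := by rw [← dist_eq_norm, hdw]
  -- the affine function supporting the distance at `u y`
  have hsupp : ∀ x, inner ℝ (u y - w) (u x - w) ≤ d (u y) * d (u x) := by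
    intro x
    obtain ⟨w', hw', hdw''⟩ := isClosed_closure.exists_infDist_eq_dist ⟨w, hw.1⟩ (u x)
    have h1 := hvar w' hw'
    have h2 := real_inner_le_norm (u y - w) (u x - w')
    rw [hvw, ← dist_eq_norm, ← hdw''] at h2
    have h3 : u x - w = (u x - w') + (w' - w) := by abel
    rw [h3, inner_add_right]
    linarith
  set φ : E → ℝ := fun x => d (u y) * ε * ‖x - x₀‖ ^ 2 with hφ
  set ψ : E → ℝ := fun x => inner ℝ (u y - w) (u x - w) with hψ
  have hφC : ContDiff ℝ 2 φ := by
    have : ContDiff ℝ 2 (fun x : E => ‖x - x₀‖ ^ 2) := (contDiff_id.sub contDiff_const).norm_sq ℝ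
    fun_prop
  have hψC : ContDiff ℝ 2 ψ := contDiff_const.inner ℝ (hu.sub contDiff_const)
  have hdy0 : 0 ≤ d (u y) := infDist_nonneg
  have hmin : IsLocalMin (φ - ψ) y := Eventually.of_forall fun x => by
    have h1 : ψ y = d (u y) ^ 2 := by
      simp only [hψ]; rw [real_inner_self_eq_norm_sq, hvw]
    have h2 := hsupp x
    have h3 := mul_le_mul_of_nonneg_left (hy x) hdy0
    simp only [Pi.sub_apply, hφ, hψ, hg] at h3 ⊢
    nlinarith
  have hΔ := laplacian_le_of_isLocalMin_sub hφC hψC hmin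
  rw [hφ, hψ, laplacian_inner_sub hu, laplacian_mul_norm_sq, heq, ← hN] at hΔ
  have h1 : 2 * N * (d (u y) * ε) ≤ 2 * N * (B * ε) := by
    have := hdB y
    gcongr
  have h2 : 2 * N * (B * ε) < κ := by
    have : κ = 2 * (N + 1) * B * ε := by rw [hε]; field_simp
    rw [this]
    nlinarith [mul_pos hBpos hεpos]
  linarith

/-! ### Contact with the boundary -/

/-- If a bounded entire solution in `closure D` touches `∂D`, it stays in `∂D`: the distance of
`u x` to `∂D` has, at each point, an upper barrier given by the affine function vanishing on a
supporting hyperplane at a nearest boundary point. -/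
theorem mem_frontier_of_laplacian_eq {D : Set V} (hopen : IsOpen D) (hne : D.Nonempty)
    (hconv : Convex ℝ D) {F : V → V} (hF : LocallyLipschitz F)
    (hFD : ∀ v ∉ closure D, ∀ v₀ ∈ frontier D,
      dist v v₀ = infDist v (frontier D) → 0 < inner ℝ (v - v₀) (F v))
    {u : E → V} (hu : ContDiff ℝ 2 u) {C : ℝ} (hC : ∀ x, ‖u x‖ ≤ C)
    (heq : ∀ x, Laplacian.laplacian u x = F (u x)) (hmem : ∀ x, u x ∈ closure D)
    {x₀ : E} (hx₀ : u x₀ ∈ frontier D) (x : E) : u x ∈ frontier D := by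
  set C' := C + (C + ‖u x₀‖) with hC'
  obtain ⟨K, hK⟩ := hF.locallyLipschitzOn.exists_lipschitzOnWith_of_compact
    (isCompact_closedBall (0 : V) C')
  have hfr : (frontier D).Nonempty := ⟨_, hx₀⟩
  rw [isClosed_frontier.mem_iff_infDist_zero hfr] at hx₀ ⊢
  refine eq_zero_of_laplacian_le_barrier (q := fun x => infDist (u x) (frontier D)) K.2
    ((continuous_infDist_pt _).comp hu.continuous) (fun _ => infDist_nonneg) (fun y => ?_) hx₀ x
  obtain ⟨w, hw, hdist⟩ := isClosed_frontier.exists_infDist_eq_dist hfr (u y)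
  have hwD : w ∉ D := fun h => (hopen.frontier_eq ▸ hw).2 h
  obtain ⟨ν, hν⟩ := exists_isSupportingNormal hopen hne hconv hwD
  have hneg : ∀ v, inner ℝ (-ν) (v - w) = inner ℝ ν (w - v) := fun v => by
    rw [inner_neg_left, ← inner_neg_right, neg_sub]
  refine ⟨fun z => inner ℝ (-ν) (u z - w), contDiff_const.inner ℝ (hu.sub contDiff_const),
    fun z => ?_, ?_, ?_⟩
  · simp only [hneg]
    exact hν.infDist_frontier_le (hmem z)
  · simp only [hneg]
    refine le_antisymm ?_ (hν.infDist_frontier_le (hmem y))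
    rw [hdist, dist_comm, dist_eq_norm]
    simpa [hν.1] using real_inner_le_norm ν (w - u y)
  · rw [laplacian_inner_sub hu, heq]
    have h1 : ‖u y‖ ≤ C := hC y
    have hwC : ‖w‖ ≤ C' := by
      have h2 : dist (u y) w ≤ dist (u y) (u x₀) := by
        rw [← hdist]
        exact infDist_le_dist_of_mem ((isClosed_frontier.mem_iff_infDist_zero hfr).2 hx₀)
      have h3 : dist (u y) (u x₀) ≤ ‖u y‖ + ‖u x₀‖ := by rw [dist_eq_norm]; exact norm_sub_le _ _
      have h4 : ‖w‖ ≤ ‖u y‖ + dist (u y) w := by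
        rw [dist_eq_norm]; exact norm_le_norm_add_norm_sub _ _
      rw [hC']
      linarith
    have hlip := hK.dist_le_mul (u y) (by
      rw [mem_closedBall, dist_zero_right, hC']
      linarith [norm_nonneg (u y), norm_nonneg (u x₀)]) w (by simpa using hwC)
    have h5 := hν.inner_nonneg hF.continuous hFD hw
    have h6 := real_inner_le_norm ν (F w - F (u y))
    rw [hν.1, one_mul, ← dist_eq_norm, dist_comm, inner_sub_right] at h6
    rw [inner_neg_left]
    simp only [hdist]
    exact (by linarith : -inner ℝ ν (F (u y)) ≤ dist (F (u y)) (F w)).trans hlip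

/-- A curve in the boundary of a strictly convex domain with locally uniform interior balls is
constant, if at each time its height over any supporting hyperplane is of order `o(s²)`. Indeed, by
cocoercivity, the normal along the curve then has zero derivative, and strict convexity makes the
boundary point a function of the normal. -/
lemma curve_const_of_isLittleO_sq {D : Set V} (hopen : IsOpen D) (hne : D.Nonempty)
    (hconv : Convex ℝ D) (hstrict : StrictConvex ℝ (closure D))
    (hball : ∀ p ∈ frontier D, ∃ ρ > 0, ∃ r > 0, ∀ w ∈ frontier D ∩ ball p ρ, ∃ c, dist w c = r ∧
      closedBall c r ⊆ closure D)
    {U : ℝ → V} (hU : Continuous U) (hfr : ∀ t, U t ∈ frontier D)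
    (hflat : ∀ t ν, IsSupportingNormal D (U t) ν →
      (fun s => inner ℝ ν (U t - U s)) =o[𝓝 t] fun s => (s - t) ^ 2) (s t : ℝ) : U s = U t := by
  have hex : ∀ t, ∃ ν, IsSupportingNormal D (U t) ν := fun t =>
    exists_isSupportingNormal hopen hne hconv fun h => (hopen.frontier_eq ▸ hfr t).2 h
  choose N hN using hex
  suffices hloc : IsLocallyConstant U from hloc.apply_eq_of_preconnectedSpace s t
  rw [IsLocallyConstant.iff_eventually_eq]
  intro t₀
  obtain ⟨ρ, hρ, r, hr, hb⟩ := hball _ (hfr t₀)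
  obtain ⟨δ, hδ, hδsub⟩ := Metric.mem_nhds_iff.1
    (hU.continuousAt.preimage_mem_nhds (ball_mem_nhds (U t₀) hρ))
  have hderiv : ∀ t ∈ ball t₀ δ, HasDerivAt N 0 t := by
    intro t ht
    have hev : ∀ᶠ s in 𝓝 t, s ∈ ball t₀ δ := isOpen_ball.mem_nhds ht
    rw [hasDerivAt_iff_isLittleO]
    simp only [smul_zero, sub_zero]
    rw [Asymptotics.isLittleO_iff]
    intro η hη
    have hη' : 0 < r / 2 * η ^ 2 := by positivity
    filter_upwards [hev, (hflat t (N t) (hN t)).def hη'] with s hs h1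
    obtain ⟨c, hc, hcD⟩ := hb (U s) ⟨hfr s, hδsub hs⟩
    have h2 := (hN t).half_mul_norm_sub_sq_le (hN s) hr.le hc hcD
    have h3 : r / 2 * ‖N t - N s‖ ^ 2 ≤ r / 2 * η ^ 2 * (s - t) ^ 2 := by
      refine (h2.trans (le_abs_self _)).trans (h1.trans_eq ?_)
      rw [Real.norm_of_nonneg (sq_nonneg _)]
    rw [norm_sub_rev, Real.norm_eq_abs]
    refine le_of_sq_le_sq ?_ (by positivity)
    rw [mul_pow, sq_abs]
    have h4 : 0 < r / 2 := by positivity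
    rw [mul_assoc] at h3
    exact le_of_mul_le_mul_left h3 h4
  have hNconst : ∀ t ∈ ball t₀ δ, N t = N t₀ := fun t ht =>
    isOpen_ball.is_const_of_deriv_eq_zero (convex_ball t₀ δ).isPreconnected
      (fun t ht => (hderiv t ht).differentiableAt.differentiableWithinAt)
      (fun t ht => (hderiv t ht).deriv) ht (mem_ball_self hδ)
  filter_upwards [ball_mem_nhds t₀ hδ] with t ht
  by_contra hne'
  have h1 := (hN t₀).2 _ (frontier_subset_closure (hfr t))
  have h2 := (hN t).2 _ (frontier_subset_closure (hfr t₀))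
  rw [hNconst t ht] at h2
  have hmid : (1 / 2 : ℝ) • U t + (1 / 2 : ℝ) • U t₀ ∈ interior (closure D) :=
    hstrict (frontier_subset_closure (hfr t)) (frontier_subset_closure (hfr t₀)) hne'
      (by norm_num) (by norm_num) (by norm_num)
  have h3 := (hN t₀).inner_lt_zero_of_mem_interior hmid
  have h4 : (1 / 2 : ℝ) • U t + (1 / 2 : ℝ) • U t₀ - U t₀ = (1 / 2 : ℝ) • (U t - U t₀) := by module
  rw [h4, inner_smul_right] at h3
  rw [← neg_sub, inner_neg_right] at h2
  linarith

/-- A solution with values in the boundary of a strictly convex domain with locally uniform interior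
balls is constant: the height over a supporting hyperplane has a maximum, so its pure second
derivatives are nonpositive, while their sum is nonnegative by the sign of `F`; hence they all
vanish. -/
theorem eq_const_of_forall_mem_frontier {D : Set V} (hopen : IsOpen D) (hne : D.Nonempty)
    (hconv : Convex ℝ D) (hstrict : StrictConvex ℝ (closure D))
    (hball : ∀ p ∈ frontier D, ∃ ρ > 0, ∃ r > 0, ∀ w ∈ frontier D ∩ ball p ρ, ∃ c, dist w c = r ∧
      closedBall c r ⊆ closure D)
    {F : V → V} (hF : Continuous F)
    (hFD : ∀ v ∉ closure D, ∀ v₀ ∈ frontier D,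
      dist v v₀ = infDist v (frontier D) → 0 < inner ℝ (v - v₀) (F v))
    {u : E → V} (hu : ContDiff ℝ 2 u) (heq : ∀ x, Laplacian.laplacian u x = F (u x))
    (hfr : ∀ x, u x ∈ frontier D) (x : E) : u x = u 0 := by
  refine eq_of_forall_basis_line_eq (stdOrthonormalBasis ℝ E) (fun x i t => ?_) x
  set e := stdOrthonormalBasis ℝ E i with he
  have hline := curve_const_of_isLittleO_sq hopen hne hconv hstrict hball
    (U := fun s : ℝ => u (x + s • e)) (contDiff_line hu x e).continuous (fun s => hfr _) ?_ t 0
  · simpa using hline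
  intro t ν hν
  set y := x + t • e with hy
  set f : E → ℝ := fun z => inner ℝ (-ν) (u z - u y) with hf
  have hfC : ContDiff ℝ 2 f := contDiff_const.inner ℝ (hu.sub contDiff_const)
  have hfy : f y = 0 := by simp [hf]
  have hf0 : ∀ z, 0 ≤ f z := fun z => by
    simp only [hf, inner_neg_left]
    linarith [hν.2 _ (frontier_subset_closure (hfr z))]
  have hmin : IsLocalMin f y := Eventually.of_forall fun z => by rw [hfy]; exact hf0 z
  have hΔ : Laplacian.laplacian f y ≤ 0 := by
    rw [hf, laplacian_inner_sub hu, heq, inner_neg_left]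
    linarith [hν.inner_nonneg hF hFD (hfr y)]
  rw [InnerProductSpace.laplacian_eq_iteratedFDeriv_stdOrthonormalBasis] at hΔ
  have hnn := fun j => hmin.iteratedFDeriv_two_nonneg hfC (stdOrthonormalBasis ℝ E j)
  have h2 : iteratedFDeriv ℝ 2 f y ![e, e] = 0 :=
    (Finset.sum_eq_zero_iff_of_nonneg fun j _ => hnn j).1
      (le_antisymm hΔ (Finset.sum_nonneg fun j _ => hnn j)) i (Finset.mem_univ i)
  have h1 : deriv (fun s : ℝ => f (x + s • e)) t = 0 :=
    IsLocalMin.deriv_eq_zero (Eventually.of_forall fun s => by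
      simp only [← hy, hfy]
      exact hf0 _)
  have hlit := isLittleO_sq_of_deriv_deriv_eq_zero (contDiff_line hfC x e) hfy h1
    ((deriv_deriv_line hfC x e t).trans h2)
  refine hlit.congr_left fun s => ?_
  simp only [hf]
  rw [inner_neg_left, ← inner_neg_right, neg_sub]

end Solutions

theorem theorem1p2 (n m : ℕ) (D : Set (EuclideanSpace ℝ (Fin m)))
    (hD_open : IsOpen D) (hD_nonempty : D.Nonempty) (hD_convex : Convex ℝ D)
    (hD_boundary : HasC2Boundary D)
    (F : EuclideanSpace ℝ (Fin m) → EuclideanSpace ℝ (Fin m)) (hF : LocallyLipschitz F)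
    (hFD : ∀ v ∉ closure D, ∀ v₀ ∈ frontier D,
      dist v v₀ = Metric.infDist v (frontier D) → 0 < inner ℝ (v - v₀) (F v))
    (u : EuclideanSpace ℝ (Fin n) → EuclideanSpace ℝ (Fin m))
    (hu : ContDiff ℝ 2 u) (hu_bdd : ∃ C : ℝ, ∀ x, ‖u x‖ ≤ C)
    (hu_eq : ∀ x, Laplacian.laplacian u x = F (u x)) :
    (∀ x, u x ∈ closure D) ∧
      (StrictConvex ℝ (closure D) → (¬ ∃ c, ∀ x, u x = c) → ∀ x, u x ∈ D) := by
  obtain ⟨C, hC⟩ := hu_bdd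
  have hmem : ∀ x, u x ∈ closure D :=
    mem_closure_of_laplacian_eq hD_nonempty hD_convex hF.continuous hFD hu hC hu_eq
  refine ⟨hmem, fun hstrict hnc x => ?_⟩
  by_contra hx
  have hxf : u x ∈ frontier D := by
    rw [hD_open.frontier_eq]
    exact ⟨hmem x, hx⟩
  have hfr := mem_frontier_of_laplacian_eq hD_open hD_nonempty hD_convex hF hFD hu hC hu_eq hmem hxf
  exact hnc ⟨u 0, eq_const_of_forall_mem_frontier hD_open hD_nonempty hD_convex hstrict
    (fun p hp => hD_boundary.exists_interior_ball hp) hF.continuous hFD hu hu_eq hfr⟩
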